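/- **Theorem 1.1.** Let $n\ge 0$ be an integer and let $C^n=[0,1]^n\subset\mathbb{R}^n$ be the unit $n$-cube with the Euclidean metric. By a finite decomposition of $C^n$ we mean a finite collection of closed subsets of $C^n$ (the pieces) whose union is $C^n$ and whose interiors relative to $C^n$ are pairwise disjoint. Then $C^n$ has no finite decomposition into pieces of Euclidean diameter less than $1$ such that every point of $C^n$ belongs to at most $n$ of the pieces. -/

import Mathlib

/-- The unit cube `[0,1]^n` in Euclidean space `ℝⁿ` (with the Euclidean distance). -/
def unitCube (n : ℕ) : Set (EuclideanSpace ℝ (Fin n)) :=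
  {x | ∀ i, x i ∈ Set.Icc (0 : ℝ) 1}

/-- A decomposition of a topological space `X`: a collection of closed subsets of `X` (the pieces)
that cover `X` and whose interiors (in `X`) are pairwise disjoint. -/
structure IsDecomposition {X : Type*} [TopologicalSpace X] (pieces : Set (Set X)) : Prop where
  isClosed : ∀ P ∈ pieces, IsClosed P
  covers : ⋃₀ pieces = Set.univ
  disjoint_interior : ∀ P ∈ pieces, ∀ Q ∈ pieces, P ≠ Q → Disjoint (interior P) (interior Q)

/-- At most `k` of the sets in the collection `pieces` meet at any one point: every point of `X`
belongs to at most `k` of them. -/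
def MeetAtMost {X : Type*} (pieces : Set (Set X)) (k : ℕ) : Prop :=
  ∀ x : X, {P | P ∈ pieces ∧ x ∈ P}.encard ≤ k

/-!
This is the Lebesgue covering theorem: if finitely many closed sets cover the cube and none of
them meets two opposite faces, then some point lies in at least `n + 1` of them. The disjointness
of the interiors plays no role, and a diameter below `1` is used only to separate opposite faces.

Give a piece `P` the label `i < n` if `i` is the least index such that `P` meets the face `xᵢ = 0`,
and the label `n` if it meets none of these faces (`faceLabel`). If a point `x` of `P` has `xᵢ = 0`,
the label of `P` is at most `i`; if it has `xᵢ = 1`, the label is not `i`. Labelling each point of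
the grid `{0, …, N}ⁿ` by some piece containing it gives a labelling to which Kuhn's cubical form of
Sperner's lemma applies (`exists_cube_all_labels`): some unit cube of the grid carries all the
labels `0, …, n`. As `N` grows, a subsequence of these small cubes converges to a point `x`. The
union of the pieces with a given label is closed, so it contains `x`; hence `x` lies in `n + 1`
pieces, one for each label.

Kuhn's lemma is proved by counting rainbow simplices modulo 2. `pathSum` integrates a function of
`(k + 1)`-tuples of vertices over the simplices that triangulate a `k`-dimensional unit cube, and
`pathSum_coboundary` is the Stokes formula for it. The mod 2 rainbow indicator is the determinant
of the 0-1 matrix that records which vertex has which label, and expansion along a column of ones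
shows that it is the coboundary of its lower-dimensional analogue (`coboundary_rainbow`).
Hence the number of rainbow `(k + 1)`-simplices in the face `x_{k+1} = ⋯ = x_{n-1} = 0` of the grid
reduces to the boundary of that face, where the labelling condition leaves only the contribution of
the face `x_k = ⋯ = x_{n-1} = 0` (`rainbowCount_succ`). So the count is the same in all dimensions,
and it is `1` in dimension `0`.
-/

/-! ### Sums over monotone lattice paths and the Stokes formula -/

/-- For `S` of cardinality `k`, the sum of `f` over all lattice paths `v = w₀, w₁, …, w_k` that take
one unit step in each direction of `S`, in any order. These paths are the simplices of the standard
(Freudenthal) triangulation of the unit cube with lowest vertex `v` and directions `S`, and no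
signs are needed modulo 2. The number of steps is a separate argument so that the recursion is
structural. -/
def pathSum {ι : Type*} [DecidableEq ι] :
    (k : ℕ) → (ι → ℕ) → Finset ι → ((Fin (k + 1) → ι → ℕ) → ZMod 2) → ZMod 2
  | 0, v, _, f => f fun _ => v
  | k + 1, v, S, f =>
    ∑ i ∈ S, pathSum k (v + Pi.single i 1) (S.erase i) fun w => f (Fin.cons v w)

/-- The simplicial coboundary modulo 2 of a function on `(k + 1)`-tuples: the sum of its values on
the faces of a `(k + 2)`-tuple. -/
def coboundary {V : Type*} {k : ℕ} (f : (Fin (k + 1) → V) → ZMod 2) (w : Fin (k + 2) → V) :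
    ZMod 2 :=
  ∑ j : Fin (k + 2), f fun i => w (j.succAbove i)

theorem coboundary_cons {V : Type*} {k : ℕ} (f : (Fin (k + 2) → V) → ZMod 2) (v : V)
    (w : Fin (k + 2) → V) :
    coboundary f (Fin.cons v w) = f w + coboundary (fun u => f (Fin.cons v u)) w := by
  unfold coboundary
  rw [Fin.sum_univ_succ]
  congr 1
  refine Finset.sum_congr rfl fun j _ => congrArg f (funext fun i => ?_)
  refine Fin.cases ?_ (fun i => ?_) i
  · simp
  · simp

section PathSum

variable {ι : Type*} [DecidableEq ι]

theorem pathSum_add (k : ℕ) (v : ι → ℕ) (S : Finset ι)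
    (f g : (Fin (k + 1) → ι → ℕ) → ZMod 2) :
    pathSum k v S (fun w => f w + g w) = pathSum k v S f + pathSum k v S g := by
  induction k generalizing v S with
  | zero => rfl
  | succ k ih => simp only [pathSum, ih, Finset.sum_add_distrib]

theorem sum_sum_erase_eq_zero (S : Finset ι) (A : ι → ι → ZMod 2) (hA : ∀ i j, A i j = A j i) :
    ∑ i ∈ S, ∑ j ∈ S.erase i, A i j = 0 := by
  rw [Finset.sum_sigma']
  refine Finset.sum_involution (fun p _ => ⟨p.2, p.1⟩) ?_ ?_ ?_ ?_
  · rintro ⟨i, j⟩ _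
    simpa only [hA j i] using CharTwo.add_self_eq_zero (A i j)
  · rintro ⟨i, j⟩ h _ heq
    simp only [Finset.mem_sigma, Finset.mem_erase] at h
    exact h.2.1 (congrArg Sigma.fst heq)
  · rintro ⟨i, j⟩ h
    simp only [Finset.mem_sigma, Finset.mem_erase] at h ⊢
    exact ⟨h.2.2, h.2.1.symm, h.1⟩
  · rintro ⟨i, j⟩ _
    rfl

/-- The Stokes formula modulo 2 for a cube: integrating a coboundary over its simplices amounts to
integrating over the lower and the upper facet in each direction. Removing the first vertex of a
path gives a path in an upper facet; the paths starting at `v` recombine, by induction, to the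
lower facets, and the remaining terms cancel in pairs. -/
theorem pathSum_coboundary (k : ℕ) (v : ι → ℕ) (S : Finset ι)
    (f : (Fin (k + 1) → ι → ℕ) → ZMod 2) :
    pathSum (k + 1) v S (coboundary f) =
      ∑ i ∈ S, (pathSum k v (S.erase i) f + pathSum k (v + Pi.single i 1) (S.erase i) f) := by
  induction k generalizing v S with
  | zero =>
    refine Finset.sum_congr rfl fun i _ => ?_
    simp only [pathSum, coboundary]
    rw [add_comm (f fun _ => v)]
    refine (Fin.sum_univ_two _).trans (congrArg₂ (· + ·) (congrArg f ?_) (congrArg f ?_))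
    · funext j
      rw [Fin.fin_one_eq_zero j]
      rfl
    · funext j
      rw [Fin.fin_one_eq_zero j]
      rfl
  | succ k ih =>
    have step : pathSum (k + 2) v S (coboundary f) =
        ∑ i ∈ S, (pathSum (k + 1) (v + Pi.single i 1) (S.erase i) f +
          pathSum (k + 1) (v + Pi.single i 1) (S.erase i)
            (coboundary fun u => f (Fin.cons v u))) := by
      rw [pathSum]
      refine Finset.sum_congr rfl fun i _ => ?_
      simp only [coboundary_cons]
      exact pathSum_add ..
    have swap : ∑ i ∈ S, ∑ j ∈ S.erase i,
        pathSum k (v + Pi.single i 1) ((S.erase i).erase j) (fun u => f (Fin.cons v u)) =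
        ∑ i ∈ S, pathSum (k + 1) v (S.erase i) f := by
      simp only [pathSum]
      rw [Finset.sum_comm' (t' := S) (s' := fun j => S.erase j)]
      · refine Finset.sum_congr rfl fun i _ => Finset.sum_congr rfl fun j _ => ?_
        rw [Finset.erase_right_comm]
      · intro i j
        simp only [Finset.mem_erase, ne_comm]
        tauto
    have cancel : ∑ i ∈ S, ∑ j ∈ S.erase i,
        pathSum k (v + Pi.single i 1 + Pi.single j 1) ((S.erase i).erase j)
          (fun u => f (Fin.cons v u)) = 0 := by
      refine sum_sum_erase_eq_zero S _ fun i j => ?_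
      rw [add_right_comm, Finset.erase_right_comm]
    rw [step]
    simp only [ih, Finset.sum_add_distrib]
    rw [swap, cancel, add_zero, add_comm]

/-- A path sum depends only on the values on tuples of vertices of the given cube. -/
theorem pathSum_congr (k : ℕ) (v : ι → ℕ) (S : Finset ι)
    {f g : (Fin (k + 1) → ι → ℕ) → ZMod 2}
    (h : ∀ w, (∀ a, v ≤ w a ∧ w a ≤ v + 1 ∧ ∀ i ∉ S, w a i = v i) → f w = g w) :
    pathSum k v S f = pathSum k v S g := by
  induction k generalizing v S with
  | zero => exact h _ fun a => ⟨le_rfl, le_self_add, fun _ _ => rfl⟩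
  | succ k ih =>
    refine Finset.sum_congr rfl fun i hi => ih _ _ fun w hw => h _ fun a => ?_
    refine Fin.cases ⟨le_rfl, le_self_add, fun _ _ => rfl⟩ (fun a => ?_) a
    obtain ⟨h1, h2, h3⟩ := hw a
    simp only [Fin.cons_succ]
    refine ⟨le_self_add.trans h1, fun j => ?_, fun j hj => ?_⟩
    · rcases eq_or_ne j i with rfl | hji
      · rw [h3 j (Finset.notMem_erase _ _)]
        simp
      · simpa [hji] using h2 j
    · have hji : j ≠ i := fun e => hj (e ▸ hi)
      rw [h3 j fun hm => hj (Finset.mem_of_mem_erase hm)]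
      simp [hji]

theorem pathSum_zero (k : ℕ) (v : ι → ℕ) (S : Finset ι) :
    pathSum k v S (fun _ => 0) = 0 := by
  induction k generalizing v S with
  | zero => rfl
  | succ k ih => simp only [pathSum, ih, Finset.sum_const_zero]

end PathSum

/-! ### The rainbow indicator modulo 2 -/

section Sperner

variable {V : Type*}

/-- The number modulo 2 of ways to match the vertices `w` with the labels `0, …, k`: it is `1` if the
labels of `w` are `0, …, k` in some order, and `0` otherwise. The determinant form covers tuples
with repeated or too large labels without a case distinction. -/
def rainbow (ℓ : V → ℕ) (k : ℕ) (w : Fin (k + 1) → V) : ZMod 2 :=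
  Matrix.det (Matrix.of fun a b : Fin (k + 1) => if ℓ (w a) = b then (1 : ZMod 2) else 0)

theorem rainbow_eq_zero {ℓ : V → ℕ} {k : ℕ} {w : Fin (k + 1) → V} {j : ℕ} (hj : j ≤ k)
    (h : ∀ a, ℓ (w a) ≠ j) : rainbow ℓ k w = 0 :=
  Matrix.det_eq_zero_of_column_eq_zero ⟨j, Nat.lt_succ_of_le hj⟩ fun a => if_neg (h a)

/-- The local form of Sperner's lemma: among tuples with labels at most `k + 1`, the number of faces
labelled `0, …, k` is odd exactly if the tuple is labelled `0, …, k + 1`. -/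
theorem coboundary_rainbow (ℓ : V → ℕ) (k : ℕ) (w : Fin (k + 2) → V)
    (h : ∀ a, ℓ (w a) ≤ k + 1) : coboundary (rainbow ℓ k) w = rainbow ℓ (k + 1) w := by
  unfold rainbow coboundary
  set A : Matrix (Fin (k + 2)) (Fin (k + 2)) (ZMod 2) :=
    Matrix.of fun a b => if ℓ (w a) = b then (1 : ZMod 2) else 0 with hA
  -- Every row of `A` has exactly one entry `1`, so the columns add up to a column of ones.
  have hsum : (fun a => ∑ b, (1 : ZMod 2) • A a b) = fun _ => (1 : ZMod 2) := by
    funext a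
    rw [Finset.sum_eq_single ⟨ℓ (w a), Nat.lt_succ_of_le (h a)⟩]
    · simp [hA]
    · intro b _ hb
      have : ℓ (w a) ≠ b := fun e => hb (Fin.ext e.symm)
      simp [hA, this]
    · simp
  have hdet := Matrix.det_updateCol_sum A (Fin.last (k + 1)) fun _ => (1 : ZMod 2)
  rw [one_smul] at hdet
  rw [← hdet, Matrix.det_succ_column _ (Fin.last (k + 1))]
  refine Finset.sum_congr rfl fun j _ => ?_
  have hsign (m : ℕ) : (-1 : ZMod 2) ^ m = 1 := by rw [CharTwo.neg_eq, one_pow]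
  have hone := congrFun hsum j
  simp only [Matrix.updateCol_self, hsign, one_mul]
  rw [hone, one_mul]
  congr 1
  ext a b
  simp [hA, Fin.succAbove_last]

end Sperner

/-! ### Kuhn's cubical form of Sperner's lemma -/

section Kuhn

variable {n : ℕ}

/-- The lowest vertices of the `k`-dimensional unit cubes that tile the face
`x_k = ⋯ = x_{n-1} = 0` of the grid `{0, …, N}ⁿ`. -/
def gridBox (n N k : ℕ) : Finset (Fin n → ℕ) :=
  Fintype.piFinset fun i => if (i : ℕ) < k then Finset.range N else {0}

theorem mem_gridBox {N k : ℕ} {v : Fin n → ℕ} :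
    v ∈ gridBox n N k ↔ ∀ i : Fin n, if (i : ℕ) < k then v i < N else v i = 0 := by
  simp only [gridBox, Fintype.mem_piFinset]
  refine forall_congr' fun i => ?_
  split_ifs <;> simp

/-- The lower and upper facets in direction `i` of the cubes of the grid cancel in pairs, except on
the boundary; `g` vanishes on the upper boundary, so the lower one remains. -/
theorem sum_gridBox_add_shift {N k : ℕ} (i : Fin n) (hi : (i : ℕ) < k)
    (g : (Fin n → ℕ) → ZMod 2) (hg : ∀ v, v i = N → g v = 0) :
    ∑ v ∈ gridBox n N k, (g v + g (v + Pi.single i 1)) =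
      ∑ v ∈ gridBox n N k with v i = 0, g v := by
  have hshift : ∑ v ∈ gridBox n N k, g (v + Pi.single i 1) =
      ∑ v ∈ gridBox n N k with ¬ v i = 0, g v := by
    rw [← Finset.sum_filter_of_ne (p := fun v => v i + 1 ≠ N)
      (fun v _ h e => h (hg _ (by simpa using e)))]
    refine Finset.sum_nbij' (fun v => v + Pi.single i 1) (fun v => v - Pi.single i 1)
      ?_ ?_ ?_ ?_ ?_
    · intro v hv
      simp only [Finset.mem_filter, mem_gridBox] at hv ⊢
      refine ⟨fun j => ?_, by simp⟩
      have := hv.1 j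
      rcases eq_or_ne j i with rfl | hji
      · simp only [hi, if_true, Pi.add_apply, Pi.single_eq_same] at this ⊢
        omega
      · simpa [hji] using this
    · intro v hv
      simp only [Finset.mem_filter, mem_gridBox] at hv ⊢
      have hvi := hv.1 i
      simp only [hi, if_true] at hvi
      refine ⟨fun j => ?_, by simp only [Pi.sub_apply, Pi.single_eq_same]; omega⟩
      have := hv.1 j
      rcases eq_or_ne j i with rfl | hji
      · simp only [hi, if_true, Pi.sub_apply, Pi.single_eq_same]
        omega
      · simpa [hji] using this
    · intro v _
      exact add_tsub_cancel_right v _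
    · intro v hv
      simp only [Finset.mem_filter] at hv
      refine tsub_add_cancel_of_le fun j => ?_
      rcases eq_or_ne j i with rfl | hji
      · simp only [Pi.single_eq_same]
        omega
      · simp [hji]
    · intro v _
      rfl
  rw [Finset.sum_add_distrib, hshift, ← Finset.sum_filter_add_sum_filter_not _ (fun v => v i = 0),
    add_assoc, CharTwo.add_self_eq_zero, add_zero]

/-- The number modulo 2 of simplices labelled `0, …, k` in the triangulated face
`x_k = ⋯ = x_{n-1} = 0` of the grid. -/
def rainbowCount (ℓ : (Fin n → ℕ) → ℕ) (N k : ℕ) : ZMod 2 :=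
  ∑ v ∈ gridBox n N k, pathSum k v {i : Fin n | (i : ℕ) < k} (rainbow ℓ k)

variable {N : ℕ} {ℓ : (Fin n → ℕ) → ℕ}

theorem rainbowCount_zero (hlow : ∀ w : Fin n → ℕ, ∀ i, w i = 0 → ℓ w ≤ i)
    (hle : ∀ w, ℓ w ≤ n) : rainbowCount ℓ N 0 = 1 := by
  have hbox : gridBox n N 0 = {0} := by
    ext v
    simp [mem_gridBox, funext_iff]
  have h0 : ℓ 0 = 0 := by
    rcases Nat.eq_zero_or_pos n with rfl | hn
    · exact Nat.le_zero.1 (hle 0)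
    · exact Nat.le_zero.1 (hlow 0 ⟨0, hn⟩ rfl)
  rw [rainbowCount, hbox, Finset.sum_singleton]
  simp [pathSum, rainbow, h0]

theorem rainbowCount_succ (hN : 0 < N)
    (hlow : ∀ w : Fin n → ℕ, ∀ i, w i = 0 → ℓ w ≤ i)
    (hhigh : ∀ w : Fin n → ℕ, ∀ i, w i = N → ℓ w ≠ i) (hle : ∀ w, ℓ w ≤ n) {k : ℕ}
    (hk : k < n) : rainbowCount ℓ N (k + 1) = rainbowCount ℓ N k := by
  set S : Finset (Fin n) := {i : Fin n | (i : ℕ) < k + 1} with hS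
  -- All labels in the face are at most `k + 1`, since `x_{k+1} = 0` there.
  have hcob : rainbowCount ℓ N (k + 1) =
      ∑ v ∈ gridBox n N (k + 1), pathSum (k + 1) v S (coboundary (rainbow ℓ k)) := by
    refine Finset.sum_congr rfl fun v hv => pathSum_congr _ _ _ fun w hw => ?_
    refine (coboundary_rainbow ℓ k w fun a => ?_).symm
    rcases Nat.lt_or_ge (k + 1) n with hlt | hge
    · refine hlow (w a) ⟨k + 1, hlt⟩ ?_
      rw [(hw a).2.2 _ (by simp)]
      simpa using mem_gridBox.1 hv ⟨k + 1, hlt⟩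
    · exact (hle _).trans hge
  simp only [hcob, pathSum_coboundary]
  rw [Finset.sum_comm]
  -- On a face `x_i = N` the label `i` is missing, so the upper facets contribute nothing.
  have hface : ∀ i ∈ S, ∑ v ∈ gridBox n N (k + 1), (pathSum k v (S.erase i) (rainbow ℓ k) +
      pathSum k (v + Pi.single i 1) (S.erase i) (rainbow ℓ k)) =
      ∑ v ∈ gridBox n N (k + 1) with v i = 0, pathSum k v (S.erase i) (rainbow ℓ k) := by
    intro i hi
    have hik : (i : ℕ) < k + 1 := by simpa [hS] using hi
    refine sum_gridBox_add_shift i hik (fun v => pathSum k v (S.erase i) (rainbow ℓ k))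
      fun v hv => ?_
    rw [← pathSum_zero k v (S.erase i)]
    refine pathSum_congr _ _ _ fun w hw => rainbow_eq_zero (Nat.lt_succ_iff.1 hik) fun a => ?_
    exact hhigh _ _ (((hw a).2.2 i (Finset.notMem_erase _ _)).trans hv)
  -- On a face `x_i = 0` with `i < k` the label `k` is missing, so only `i = k` contributes.
  rw [Finset.sum_congr rfl hface, Finset.sum_eq_single (⟨k, hk⟩ : Fin n)]
  · refine Finset.sum_congr ?_ fun v _ => ?_
    · ext v
      simp only [Finset.mem_filter, mem_gridBox]
      constructor
      · rintro ⟨h, h0⟩ i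
        have := h i
        rcases lt_trichotomy (i : ℕ) k with hi | hi | hi
        · simpa [hi, hi.trans (Nat.lt_succ_self k)] using this
        · obtain rfl : i = ⟨k, hk⟩ := Fin.ext hi
          simpa using h0
        · simpa [hi.not_gt, (Nat.succ_le_of_lt hi).not_gt] using this
      · intro h
        have h0 : v ⟨k, hk⟩ = 0 := by simpa using h ⟨k, hk⟩
        refine ⟨fun i => ?_, h0⟩
        have := h i
        rcases lt_trichotomy (i : ℕ) k with hi | hi | hi
        · simpa [hi, hi.trans (Nat.lt_succ_self k)] using this
        · obtain rfl : i = ⟨k, hk⟩ := Fin.ext hi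
          simpa [h0] using hN
        · simpa [hi.not_gt, (Nat.succ_le_of_lt hi).not_gt] using this
    · congr 1
      ext i
      simp only [hS, Finset.mem_erase, Finset.mem_filter, Finset.mem_univ, true_and, ne_eq,
        Fin.ext_iff]
      omega
  · intro i hi hik
    have hlt : (i : ℕ) < k := by
      have h1 : (i : ℕ) < k + 1 := by simpa [hS] using hi
      have h2 : (i : ℕ) ≠ k := fun e => hik (Fin.ext e)
      omega
    refine Finset.sum_eq_zero fun v hv => ?_
    rw [← pathSum_zero k v (S.erase i)]
    refine pathSum_congr _ _ _ fun w hw => rainbow_eq_zero le_rfl fun a => ?_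
    have h0 : w a i = 0 :=
      ((hw a).2.2 i (Finset.notMem_erase _ _)).trans (Finset.mem_filter.1 hv).2
    exact ((hlow _ _ h0).trans_lt hlt).ne
  · intro h
    exact absurd (by simp [hS]) h

/-- Kuhn's lemma: a labelling of lattice points by `0, …, n` with labels at most `i` where `x_i = 0`
and different from `i` where `x_i = N` has a unit cube in the grid `{0, …, N}ⁿ` carrying all labels.
Only the labels in the grid matter, but the hypotheses are stated on all of `ℕⁿ`. -/
theorem exists_cube_all_labels (hN : 0 < N)
    (hlow : ∀ w : Fin n → ℕ, ∀ i, w i = 0 → ℓ w ≤ i)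
    (hhigh : ∀ w : Fin n → ℕ, ∀ i, w i = N → ℓ w ≠ i) (hle : ∀ w, ℓ w ≤ n) :
    ∃ v : Fin n → ℕ, (∀ i, v i < N) ∧ ∀ j ≤ n, ∃ w, v ≤ w ∧ w ≤ v + 1 ∧ ℓ w = j := by
  have hcount : ∀ k ≤ n, rainbowCount ℓ N k = 1 := by
    intro k
    induction k with
    | zero => exact fun _ => rainbowCount_zero hlow hle
    | succ k ih =>
      exact fun hk => (rainbowCount_succ hN hlow hhigh hle hk).trans (ih (Nat.le_of_succ_le hk))
  have hne : rainbowCount ℓ N n ≠ 0 := by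
    rw [hcount n le_rfl]
    exact one_ne_zero
  obtain ⟨v, hv, hv0⟩ := Finset.exists_ne_zero_of_sum_ne_zero hne
  refine ⟨v, fun i => by simpa using mem_gridBox.1 hv i, fun j hj => ?_⟩
  by_contra! hno
  refine hv0 ?_
  rw [← pathSum_zero n v {i : Fin n | (i : ℕ) < n}]
  exact pathSum_congr _ _ _ fun w hw =>
    rainbow_eq_zero hj fun a => hno (w a) (hw a).1 (hw a).2.1

end Kuhn

/-! ### Labelling the pieces by the faces they meet -/

theorem isCompact_unitCube (n : ℕ) : IsCompact (unitCube n) := by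
  have h : unitCube n =
      (EuclideanSpace.equiv (Fin n) ℝ).symm '' Set.univ.pi fun _ => Set.Icc (0 : ℝ) 1 := by
    ext x
    rw [ContinuousLinearEquiv.image_symm_eq_preimage]
    simp only [unitCube, Set.mem_ofPred_eq, Set.mem_preimage, Set.mem_univ_pi]
    rfl
  rw [h]
  exact (isCompact_univ_pi fun _ => isCompact_Icc).image
    (EuclideanSpace.equiv (Fin n) ℝ).symm.continuous

section Labels

variable {n : ℕ}

/-- The least `i` such that `P` meets the face `x_i = 0` of the cube, or `n` if there is none. -/
noncomputable def faceLabel (P : Set (unitCube n)) : ℕ :=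
  sInf {m | m = n ∨ ∃ i : Fin n, (i : ℕ) = m ∧ ∃ x ∈ P, x.1 i = 0}

theorem faceLabel_le (P : Set (unitCube n)) : faceLabel P ≤ n :=
  Nat.sInf_le (Or.inl rfl)

theorem faceLabel_le_of_mem {P : Set (unitCube n)} {x : unitCube n} (hx : x ∈ P) {i : Fin n}
    (h : x.1 i = 0) : faceLabel P ≤ i :=
  Nat.sInf_le (Or.inr ⟨i, rfl, x, hx, h⟩)

theorem exists_mem_of_faceLabel_eq {P : Set (unitCube n)} {i : Fin n} (h : faceLabel P = i) :
    ∃ x ∈ P, x.1 i = 0 := by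
  have hmem : faceLabel P ∈ {m | m = n ∨ ∃ i : Fin n, (i : ℕ) = m ∧ ∃ x ∈ P, x.1 i = 0} :=
    Nat.sInf_mem ⟨n, Or.inl rfl⟩
  rcases hmem with hn | ⟨j, hj, hx⟩
  · exact absurd (h.symm.trans hn) i.isLt.ne
  · rwa [← Fin.ext (hj.trans h)]

theorem faceLabel_ne_of_mem {P : Set (unitCube n)} (hP : Metric.diam P < 1) {x : unitCube n}
    (hx : x ∈ P) {i : Fin n} (h : x.1 i = 1) : faceLabel P ≠ i := by
  intro e
  obtain ⟨y, hy, hy0⟩ := exists_mem_of_faceLabel_eq e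
  have := isCompact_iff_compactSpace.1 (isCompact_unitCube n)
  have hbdd : Bornology.IsBounded P := isCompact_univ.isBounded.subset (Set.subset_univ P)
  have h1 : dist x y < 1 := (Metric.dist_le_diam_of_mem hbdd hx hy).trans_lt hP
  have h2 : ‖(x.1 - y.1) i‖ ≤ ‖x.1 - y.1‖ := PiLp.norm_apply_le _ i
  rw [Subtype.dist_eq, dist_eq_norm] at h1
  simp only [PiLp.sub_apply, h, hy0, sub_zero, norm_one] at h2
  exact h2.not_gt h1

end Labels

/-! ### From fine grids to a common point -/

/-- The point of the cube at the vertex `w` of the grid of mesh `1 / (m + 1)`. Coordinates are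
truncated at `1`, so that the point is defined for all `w`. -/
noncomputable def gridPoint {n : ℕ} (m : ℕ) (w : Fin n → ℕ) : unitCube n :=
  ⟨WithLp.toLp 2 fun i => min ((w i : ℝ) / (m + 1)) 1, fun i =>
    ⟨le_min (by positivity) zero_le_one, min_le_right _ _⟩⟩

theorem tendsto_gridPoint {n : ℕ} {φ : ℕ → ℕ} (hφ : Filter.Tendsto φ Filter.atTop Filter.atTop)
    {v w : ℕ → Fin n → ℕ} (h1 : ∀ m, v m ≤ w m) (h2 : ∀ m, w m ≤ v m + 1) {x : unitCube n}
    (hx : Filter.Tendsto (fun m => gridPoint (φ m) (v m)) Filter.atTop (nhds x)) :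
    Filter.Tendsto (fun m => gridPoint (φ m) (w m)) Filter.atTop (nhds x) := by
  have hcoord (u : ℕ → Fin n → ℕ) :
      Filter.Tendsto (fun m => gridPoint (φ m) (u m)) Filter.atTop (nhds x) ↔
      ∀ i, Filter.Tendsto (fun m => min ((u m i : ℝ) / (φ m + 1)) 1) Filter.atTop
        (nhds (x.1 i)) := by
    rw [tendsto_subtype_rng,
      (EuclideanSpace.equiv (Fin n) ℝ).toHomeomorph.isInducing.tendsto_nhds_iff, tendsto_pi_nhds]
    rfl
  rw [hcoord] at hx ⊢
  intro i
  have hlim : Filter.Tendsto (fun m => min ((v m i : ℝ) / (φ m + 1)) 1 + 1 / ((φ m : ℝ) + 1))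
      Filter.atTop (nhds (x.1 i)) := by
    simpa using (hx i).add (tendsto_one_div_add_atTop_nhds_zero_nat.comp hφ)
  refine tendsto_of_tendsto_of_tendsto_of_le_of_le (hx i) hlim (fun m => ?_) fun m => ?_
  · have : (v m i : ℝ) ≤ w m i := by exact_mod_cast h1 m i
    dsimp only
    gcongr
  · have h3 : (w m i : ℝ) ≤ v m i + 1 := by exact_mod_cast h2 m i
    have hpos : (0 : ℝ) < 1 / ((φ m : ℝ) + 1) := by positivity
    have h4 : (w m i : ℝ) / (φ m + 1) ≤ v m i / (φ m + 1) + 1 / (φ m + 1) := by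
      rw [← add_div]
      gcongr
    dsimp only
    rw [← min_add_add_right]
    exact min_le_min h4 (by linarith)

theorem theorem1p1 (n : ℕ) :
    ¬ ∃ pieces : Set (Set (unitCube n)),
      pieces.Finite ∧ IsDecomposition pieces ∧
      (∀ P ∈ pieces, Metric.diam P < 1) ∧ MeetAtMost pieces n := by
  rintro ⟨pieces, hfin, hdec, hdiam, hmeet⟩
  have := isCompact_iff_compactSpace.1 (isCompact_unitCube n)
  have hcov (x : unitCube n) : ∃ P ∈ pieces, x ∈ P :=
    Set.mem_sUnion.1 (hdec.covers ▸ Set.mem_univ x)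
  choose piece hpiece hmem using hcov
  have hcube (m : ℕ) := exists_cube_all_labels (N := m + 1)
    (ℓ := fun w : Fin n → ℕ => faceLabel (piece (gridPoint m w))) m.succ_pos
    (fun w i h => faceLabel_le_of_mem (hmem _) (by simp [gridPoint, h]))
    (fun w i h => faceLabel_ne_of_mem (hdiam _ (hpiece _)) (hmem _) (by
      have : ((m : ℝ) + 1) ≠ 0 := by positivity
      simp [gridPoint, h, div_self this]))
    (fun w => faceLabel_le _)
  choose v _ hv using hcube
  choose! w hvw hwv hlabel using hv
  obtain ⟨x, φ, hφ, hx⟩ := CompactSpace.tendsto_subseq fun m => gridPoint m (v m)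
  have hlim : ∀ j : Fin (n + 1), ∃ P ∈ pieces, x ∈ P ∧ faceLabel P = j := by
    intro j
    have hj : (j : ℕ) ≤ n := Nat.lt_succ_iff.1 j.isLt
    have hclosed : IsClosed (⋃ P ∈ {P | P ∈ pieces ∧ faceLabel P = j}, P) :=
      (hfin.subset fun P hP => hP.1).isClosed_biUnion fun P hP => hdec.isClosed P hP.1
    have hxj := hclosed.mem_of_tendsto
      (tendsto_gridPoint hφ.tendsto_atTop (w := fun m => w (φ m) j) (fun m => hvw _ _ hj)
        (fun m => hwv _ _ hj) hx)
      (Filter.Eventually.of_forall fun m =>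
        Set.mem_biUnion ⟨hpiece _, hlabel (φ m) j hj⟩ (hmem _))
    obtain ⟨P, ⟨hP, hPj⟩, hxP⟩ := Set.mem_iUnion₂.1 hxj
    exact ⟨P, hP, hxP, hPj⟩
  choose Q hQ hxQ hQlabel using hlim
  have hinj : Function.Injective Q := fun a b h =>
    Fin.ext ((hQlabel a).symm.trans ((congrArg faceLabel h).trans (hQlabel b)))
  have hcard : ((n + 1 : ℕ) : ℕ∞) ≤ n := by
    calc ((n + 1 : ℕ) : ℕ∞) = (Set.range Q).encard := by
          rw [← Set.image_univ, hinj.encard_image, Set.encard_univ]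
          simp
      _ ≤ {P | P ∈ pieces ∧ x ∈ P}.encard :=
          Set.encard_le_encard (Set.range_subset_iff.2 fun j => ⟨hQ j, hxQ j⟩)
      _ ≤ n := hmeet x
  exact absurd (Nat.cast_le.1 hcard) (Nat.not_succ_le_self n)
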